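/- **Theorem (Pure DP lower bound for private regression).** There is an absolute constant $c>0$ such that the following holds. Let $d\ge 1$ and $n\ge 0$ be integers, and let $L>1$, $\alpha>0$, $R>8\alpha/\sqrt{L}$, $\epsilon\in(0,1)$ and $\beta\in(0,1/2]$ be real numbers. Let $M$ be a randomized algorithm that takes a data set of $n$ records in $\mathbb{R}^d\times\mathbb{R}$ and outputs a vector in $\mathbb{R}^d$. Suppose that 1. $M$ is $\epsilon$-differentially private: for all data sets $X,X'$ of $n$ records at Hamming distance $1$ and every measurable set $A\subseteq\mathbb{R}^d$, $\Pr[M(X)\in A]\le e^{\epsilon}\,\Pr[M(X')\in A]$; 2. $M$ is accurate: for every positive semidefinite $\Sigma\in\mathbb{R}^{d\times d}$ with $\Sigma\preceq L\cdot I$ and every $\theta\in\mathbb{R}^d$ with $\|\theta\|_2\le R$, if $(x_1,y_1),\dots,(x_n,y_n)$ are i.i.d. copies of $(x,y)$, where $x\sim\mathcal N(0,\Sigma)$ and $y=\langle\theta,x\rangle+\zeta$ with $\zeta\sim\mathcal N(0,1)$ independent of $x$, then with probability at least $1-\beta$ over the samples and the randomness of $M$, the output $\hat\theta=M((x_1,y_1),\dots,(x_n,y_n))$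 satisfies $\|\Sigma^{1/2}(\theta-\hat\theta)\|_2\le\alpha$. Then $$n\;\ge\; c\left(\frac{d+\log(1/\beta)}{\alpha^2}+\frac{d+\log(1/\beta)}{\alpha\epsilon}+\frac{d\log\bigl(R\sqrt{L}/\alpha\bigr)+\log(1/\beta)}{\epsilon}\right).$$ -/

import Mathlib

open MeasureTheory ProbabilityTheory
open scoped MatrixOrder

namespace PrivateRegression

/-- The law of one labelled sample `(x, y)` with `x ∼ N(0, S)`, `y = ⟪θ, x⟫ + ζ`, where the noise
`ζ ∼ N(0, 1)` is independent of `x`. -/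
noncomputable def regressionLaw {d : ℕ} (S : Matrix (Fin d) (Fin d) ℝ)
    (θ : EuclideanSpace ℝ (Fin d)) : Measure (EuclideanSpace ℝ (Fin d) × ℝ) :=
  ((multivariateGaussian 0 S).prod (gaussianReal 0 1)).map
    (fun p => (p.1, inner ℝ θ p.1 + p.2))

/-- The prediction error `‖S^{1/2} (θ - θ')‖₂`. -/
noncomputable def predictionError {d : ℕ} (S : Matrix (Fin d) (Fin d) ℝ)
    (θ θ' : EuclideanSpace ℝ (Fin d)) : ℝ :=
  ‖Matrix.toEuclideanCLM (𝕜 := ℝ) (CFC.sqrt S) (θ - θ')‖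

open Classical in
/-- Pure `ε`-differential privacy of a randomized algorithm on data sets of `n` records: the output
distributions on any two data sets at Hamming distance one differ by a factor of at most `exp ε`
on every event. -/
def IsPureDP {X O : Type*} [MeasurableSpace X] [MeasurableSpace O] {n : ℕ} (ε : ℝ)
    (M : Kernel (Fin n → X) O) : Prop :=
  ∀ D D' : Fin n → X, hammingDist D D' = 1 → ∀ A : Set O, MeasurableSet A →
    M D A ≤ ENNReal.ofReal (Real.exp ε) * M D' A

/-- On `n` i.i.d. samples from any Gaussian regression instance with covariance `0 ⪯ S ⪯ L • I` and
parameter `‖θ‖₂ ≤ R`, the randomized algorithm `M` outputs, with probability at least `1 - β`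
over the samples and its own randomness, a point of prediction error at most `α`. -/
def IsAccurate {d n : ℕ} (L R α β : ℝ)
    (M : Kernel (Fin n → EuclideanSpace ℝ (Fin d) × ℝ) (EuclideanSpace ℝ (Fin d))) : Prop :=
  ∀ (S : Matrix (Fin d) (Fin d) ℝ) (θ : EuclideanSpace ℝ (Fin d)),
    S.PosSemidef → (L • (1 : Matrix (Fin d) (Fin d) ℝ) - S).PosSemidef → ‖θ‖ ≤ R →
    ENNReal.ofReal (1 - β) ≤
      (Measure.pi (fun _ : Fin n => regressionLaw S θ)).bind M
        {θ' | predictionError S θ θ' ≤ α}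

end PrivateRegression

namespace PrivateRegression

open scoped ENNReal

/-! ### From one record to `n` independent records -/

section Tensorization

variable {X : Type*} [MeasurableSpace X]

/-! Take covariance `L • 1`, and compare an instance `θ` with the null instance `0`. Accuracy puts
mass at least 1/2 on the ball of radius `a = α / √L` about `θ` when the data come from `θ`. If the
null output law gives this ball mass at most `q`, then `n` records must carry the mass from `q` up
to 1/2.

With `F D` the probability that `M D` lands in the ball, there are three bounds on this transfer.
Privacy alone gains a factor `exp ε` per record. Privacy together with total variation at most `s`
gains `1 + (exp ε - 1) * s`, where `s` is of order `α` when `‖θ‖ ≤ 8 * a` and `α` is small. Without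
privacy, Cauchy–Schwarz gains `1 + O(α ^ 2)` per record, at the price of squaring the 1/2.

The small `q` comes from three choices of `θ`. Averaging over a ball of radius `R` or `8 * a`
(`exists_measure_closedBall_le`) gives `(a / R) ^ d` or `8⁻ᵈ`, hence the dimension terms. A point at
distance `8 * a` has its ball disjoint from the one about `0`, where the null instance must succeed,
so `q = β`. -/

lemma lintegral_pi_succ (μ : Measure X) [IsProbabilityMeasure μ] {n : ℕ}
    {F : (Fin (n + 1) → X) → ℝ≥0∞} (hF : Measurable F) :
    ∫⁻ D, F D ∂(Measure.pi fun _ => μ)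
      = ∫⁻ x, ∫⁻ y, F (Fin.cons x y) ∂(Measure.pi fun _ : Fin n => μ) ∂μ := by
  have h := (measurePreserving_piFinSuccAbove (fun _ : Fin (n + 1) => μ) 0).symm
  rw [← h.lintegral_comp_emb (MeasurableEquiv.measurableEmbedding _), lintegral_prod]
  · simp [MeasurableEquiv.piFinSuccAbove, Fin.insertNthEquiv]
  · exact (hF.comp (MeasurableEquiv.measurable _)).aemeasurable

lemma measurable_fin_cons {n : ℕ} :
    Measurable fun p : X × (Fin n → X) => (Fin.cons p.1 p.2 : Fin (n + 1) → X) := by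
  refine measurable_pi_lambda _ fun i => ?_
  refine Fin.cases ?_ (fun j => ?_) i
  · simpa using measurable_fst
  · simp only [Fin.cons_succ]
    exact (measurable_pi_apply j).comp measurable_snd

/-- A one-record comparison of expectations of functions of bounded ratio tensorizes. -/
lemma lintegral_pi_le_of_bounded_ratio {P Q : Measure X} [IsProbabilityMeasure P]
    [IsProbabilityMeasure Q] {a T : ℝ≥0∞}
    (h : ∀ f : X → ℝ≥0∞, Measurable f → (∀ x x', f x ≤ a * f x') →
      ∫⁻ x, f x ∂P ≤ T * ∫⁻ x, f x ∂Q) (n : ℕ) :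
    ∀ F : (Fin n → X) → ℝ≥0∞, Measurable F →
      (∀ D i v, F D ≤ a * F (Function.update D i v)) →
      ∫⁻ D, F D ∂(Measure.pi fun _ => P) ≤ T ^ n * ∫⁻ D, F D ∂(Measure.pi fun _ => Q) := by
  induction n with
  | zero =>
    intro F hF _
    rw [Measure.pi_of_empty (fun _ => P) default, Measure.pi_of_empty (fun _ => Q) default]
    simp
  | succ n ih =>
    intro F hF hr
    have hm : Measurable fun p : X × (Fin n → X) => F (Fin.cons p.1 p.2) :=
      hF.comp measurable_fin_cons
    rw [lintegral_pi_succ P hF, lintegral_pi_succ Q hF]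
    calc ∫⁻ x, ∫⁻ y, F (Fin.cons x y) ∂(Measure.pi fun _ : Fin n => P) ∂P
        ≤ ∫⁻ x, T ^ n * ∫⁻ y, F (Fin.cons x y) ∂(Measure.pi fun _ : Fin n => Q) ∂P := by
          refine lintegral_mono fun x => ih (fun y => F (Fin.cons x y))
            (hm.comp measurable_prodMk_left) fun D i v => ?_
          have := hr (Fin.cons x D) i.succ v
          rwa [← Fin.cons_update] at this
      _ = T ^ n * ∫⁻ x, ∫⁻ y, F (Fin.cons x y) ∂(Measure.pi fun _ : Fin n => Q) ∂P :=
          lintegral_const_mul _ hm.lintegral_prod_right'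
      _ ≤ T ^ n * (T * ∫⁻ x, ∫⁻ y, F (Fin.cons x y) ∂(Measure.pi fun _ : Fin n => Q) ∂Q) := by
          gcongr
          -- Integrating out the other records preserves the ratio bound in the first one.
          refine h _ hm.lintegral_prod_right' fun x x' => ?_
          have hx' : Measurable fun y => F (Fin.cons x' y) := hm.comp measurable_prodMk_left
          rw [← lintegral_const_mul _ hx']
          refine lintegral_mono fun y => ?_
          have := hr (Fin.cons x y) 0 x'
          rwa [Fin.update_cons_zero] at this
      _ = _ := by rw [pow_succ, mul_assoc]

/-- A one-record second-moment comparison of expectations tensorizes. -/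
lemma sq_lintegral_pi_le {P Q : Measure X} [IsProbabilityMeasure P]
    [IsProbabilityMeasure Q] {K : ℝ≥0∞}
    (h : ∀ f : X → ℝ≥0∞, Measurable f → (∫⁻ x, f x ∂P) ^ 2 ≤ K * ∫⁻ x, f x ^ 2 ∂Q) (n : ℕ) :
    ∀ F : (Fin n → X) → ℝ≥0∞, Measurable F →
      (∫⁻ D, F D ∂(Measure.pi fun _ => P)) ^ 2
        ≤ K ^ n * ∫⁻ D, F D ^ 2 ∂(Measure.pi fun _ => Q) := by
  induction n with
  | zero =>
    intro F hF
    rw [Measure.pi_of_empty (fun _ => P) default, Measure.pi_of_empty (fun _ => Q) default]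
    simp
  | succ n ih =>
    intro F hF
    have hm : Measurable fun p : X × (Fin n → X) => F (Fin.cons p.1 p.2) :=
      hF.comp measurable_fin_cons
    rw [lintegral_pi_succ P hF, lintegral_pi_succ Q (hF.pow_const 2)]
    calc (∫⁻ x, ∫⁻ y, F (Fin.cons x y) ∂(Measure.pi fun _ : Fin n => P) ∂P) ^ 2
        ≤ K * ∫⁻ x, (∫⁻ y, F (Fin.cons x y) ∂(Measure.pi fun _ : Fin n => P)) ^ 2 ∂Q :=
          h _ hm.lintegral_prod_right'
      _ ≤ K * ∫⁻ x, K ^ n * ∫⁻ y, F (Fin.cons x y) ^ 2 ∂(Measure.pi fun _ : Fin n => Q) ∂Q := by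
          gcongr with x
          exact ih (fun y => F (Fin.cons x y)) (hm.comp measurable_prodMk_left)
      _ = _ := by
          rw [lintegral_const_mul _ (hm.pow_const 2).lintegral_prod_right', pow_succ']
          ring

end Tensorization

/-! ### Change of measure for one record -/

section Density

variable {X : Type*} [MeasurableSpace X]

lemma sq_lintegral_mul_le (μ : Measure X) {f g : X → ℝ≥0∞} (hf : Measurable f)
    (hg : Measurable g) :
    (∫⁻ x, f x * g x ∂μ) ^ 2 ≤ (∫⁻ x, f x ^ 2 ∂μ) * ∫⁻ x, g x ^ 2 ∂μ := by
  have h := ENNReal.lintegral_mul_le_Lp_mul_Lq μ Real.HolderConjugate.two_two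
    hf.aemeasurable hg.aemeasurable
  simp only [ENNReal.rpow_two] at h
  have h2 : ∀ a : ℝ≥0∞, (a ^ (1 / 2 : ℝ)) ^ 2 = a := fun a => by
    rw [← ENNReal.rpow_two, ← ENNReal.rpow_mul]; norm_num
  calc (∫⁻ x, f x * g x ∂μ) ^ 2
      ≤ ((∫⁻ x, f x ^ 2 ∂μ) ^ (1 / 2 : ℝ) * (∫⁻ x, g x ^ 2 ∂μ) ^ (1 / 2 : ℝ)) ^ 2 := by
        gcongr; exact h
    _ = _ := by rw [mul_pow, h2, h2]

lemma sq_lintegral_withDensity_le (Q : Measure X) {p : X → ℝ≥0∞} (hp : Measurable p)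
    {K : ℝ≥0∞} (hK : ∫⁻ x, p x ^ 2 ∂Q ≤ K) {f : X → ℝ≥0∞} (hf : Measurable f) :
    (∫⁻ x, f x ∂(Q.withDensity p)) ^ 2 ≤ K * ∫⁻ x, f x ^ 2 ∂Q := by
  rw [lintegral_withDensity_eq_lintegral_mul _ hp hf]
  exact (sq_lintegral_mul_le Q hp hf).trans (by gcongr)

/-- A probability density with `∫ p² ≤ 1 + s²` deviates above one by at most `s` on average. -/
lemma lintegral_sub_one_le (Q : Measure X) [IsProbabilityMeasure Q] {p : X → ℝ≥0∞}
    (hp : Measurable p) (hp1 : ∫⁻ x, p x ∂Q = 1) {s : ℝ≥0∞}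
    (hK : ∫⁻ x, p x ^ 2 ∂Q ≤ 1 + s ^ 2) : ∫⁻ x, (p x - 1) ∂Q ≤ s := by
  have hm : Measurable fun x => p x - 1 := hp.sub_const 1
  have key : ∀ a : ℝ≥0∞, (a - 1) ^ 2 + 2 * a ≤ a ^ 2 + 1 := by
    intro a
    rcases le_total a 1 with h | h
    · rw [tsub_eq_zero_of_le h]
      lift a to NNReal using ne_top_of_le_ne_top ENNReal.one_ne_top h
      norm_cast
      have : (0 : ℝ) ≤ (a - 1) ^ 2 := sq_nonneg _
      rw [← NNReal.coe_le_coe]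
      push_cast
      nlinarith
    · obtain ⟨b, rfl⟩ := exists_add_of_le h
      rw [ENNReal.add_sub_cancel_left ENNReal.one_ne_top]
      exact le_of_eq (by ring)
  have h1 : ∫⁻ x, (p x - 1) ^ 2 ∂Q + 2 ≤ s ^ 2 + 2 := by
    calc ∫⁻ x, (p x - 1) ^ 2 ∂Q + 2
        = ∫⁻ x, ((p x - 1) ^ 2 + 2 * p x) ∂Q := by
          rw [lintegral_add_left (hm.pow_const 2), lintegral_const_mul _ hp, hp1, mul_one]
      _ ≤ ∫⁻ x, (p x ^ 2 + 1) ∂Q := lintegral_mono fun x => key (p x)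
      _ = ∫⁻ x, p x ^ 2 ∂Q + 1 := by
          rw [lintegral_add_left (hp.pow_const 2)]; simp
      _ ≤ 1 + s ^ 2 + 1 := by gcongr
      _ = s ^ 2 + 2 := by ring
  have h2 : ∫⁻ x, (p x - 1) ^ 2 ∂Q ≤ s ^ 2 := (ENNReal.add_le_add_iff_right (by simp)).1 h1
  have h3 := sq_lintegral_mul_le Q hm (measurable_const (a := (1 : ℝ≥0∞)))
  simp only [mul_one, one_pow, lintegral_const, measure_univ] at h3
  exact (ENNReal.pow_le_pow_left_iff two_ne_zero).1 (h3.trans h2)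

/-- Functions of bounded ratio cannot distinguish `p • Q` from `Q` better than the total variation
distance permits. -/
lemma lintegral_withDensity_le_of_bounded_ratio (Q : Measure X) [IsProbabilityMeasure Q]
    {p : X → ℝ≥0∞} (hp : Measurable p) (hp1 : ∫⁻ x, p x ∂Q = 1) {b s : ℝ≥0∞} (hb : b ≠ ∞)
    (hs : ∫⁻ x, (p x - 1) ∂Q ≤ s) {f : X → ℝ≥0∞} (hf : Measurable f)
    (hr : ∀ x x', f x ≤ (1 + b) * f x') :
    ∫⁻ x, f x ∂(Q.withDensity p) ≤ (1 + b * s) * ∫⁻ x, f x ∂Q := by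
  have hX : Nonempty X := Q.nonempty_of_neZero
  rw [lintegral_withDensity_eq_lintegral_mul _ hp hf]
  set δ := ∫⁻ x, (p x - 1) ∂Q with hδ
  set m := ⨅ x, f x with hmdef
  -- Since `p` has mean one, its excess above 1 and its deficit below 1 have equal integrals.
  have hδ' : ∫⁻ x, (1 - p x) ∂Q = δ := by
    have e : ∀ x, p x + (1 - p x) = 1 + (p x - 1) := fun x => by
      rw [add_tsub_eq_max, add_tsub_eq_max, max_comm]
    have h := lintegral_congr (μ := Q) e
    rw [lintegral_add_left hp, lintegral_add_left measurable_const, hp1] at h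
    simpa using h
  have hfm : ∀ x, f x ≤ (1 + b) * m := by
    intro x
    rw [hmdef, ENNReal.mul_iInf_of_ne (by simp) (by simp [hb])]
    exact le_iInf fun x' => hr x x'
  have hmf : ∀ x, m ≤ f x := fun x => iInf_le _ _
  have hmin : Measurable fun x => min (p x) 1 * f x := (hp.min measurable_const).mul hf
  -- The excess mass `δ` is charged at most `(1 + b) * m`, while the deficit saves at least `δ * m`;
  -- only `b * δ * m` remains, and `m` is at most the mean of `f`.
  have upper : ∫⁻ x, (p * f) x ∂Q ≤ ∫⁻ x, min (p x) 1 * f x ∂Q + δ * ((1 + b) * m) := by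
    rw [hδ, ← lintegral_mul_const _ (hp.sub_const 1), ← lintegral_add_left hmin]
    refine lintegral_mono fun x => ?_
    calc p x * f x = min (p x) 1 * f x + (p x - 1) * f x := by
          rw [← add_mul]; congr 1; rcases le_total (p x) 1 with h | h
          · simp [h, tsub_eq_zero_of_le h]
          · simp [h]
      _ ≤ _ := by gcongr; exact hfm x
  have lower : ∫⁻ x, min (p x) 1 * f x ∂Q + δ * m ≤ ∫⁻ x, f x ∂Q := by
    have hp' : Measurable fun x => 1 - p x := measurable_const.sub hp
    rw [← hδ', ← lintegral_mul_const _ hp', ← lintegral_add_left hmin]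
    refine lintegral_mono fun x => ?_
    calc min (p x) 1 * f x + (1 - p x) * m ≤ min (p x) 1 * f x + (1 - p x) * f x := by
          gcongr; exact hmf x
      _ = f x := by
          rw [← add_mul]; rcases le_total (p x) 1 with h | h
          · simp [h]
          · simp [h, tsub_eq_zero_of_le h]
  have hmi : m ≤ ∫⁻ x, f x ∂Q := by
    calc m = ∫⁻ _, m ∂Q := by simp
      _ ≤ _ := lintegral_mono hmf
  calc ∫⁻ x, (p * f) x ∂Q ≤ ∫⁻ x, min (p x) 1 * f x ∂Q + δ * ((1 + b) * m) := upper
    _ = (∫⁻ x, min (p x) 1 * f x ∂Q + δ * m) + b * δ * m := by ring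
    _ ≤ ∫⁻ x, f x ∂Q + b * s * ∫⁻ x, f x ∂Q := by gcongr
    _ = _ := by ring

lemma lintegral_le_of_bounded_ratio (P Q : Measure X) [IsProbabilityMeasure P]
    [IsProbabilityMeasure Q] {a : ℝ≥0∞} {f : X → ℝ≥0∞} (hf : Measurable f)
    (hr : ∀ x x', f x ≤ a * f x') : ∫⁻ x, f x ∂P ≤ a * ∫⁻ x, f x ∂Q := by
  rw [← lintegral_const_mul _ hf]
  calc ∫⁻ x, f x ∂P ≤ ∫⁻ _, (∫⁻ x', a * f x' ∂Q) ∂P := by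
        refine lintegral_mono fun x => ?_
        calc f x = ∫⁻ _, f x ∂Q := by simp
          _ ≤ _ := lintegral_mono fun x' => hr x x'
    _ = _ := by simp

end Density

/-! ### Gaussian likelihood ratios and their second moments -/

section Gaussian

/-- The likelihood ratio of `N(u, 1)` against `N(0, 1)`. -/
noncomputable def gaussianTilt (u z : ℝ) : ℝ≥0∞ := ENNReal.ofReal (Real.exp (z * u - u ^ 2 / 2))

lemma lintegral_gaussianReal_add (u : ℝ) {g : ℝ → ℝ≥0∞} (hg : Measurable g) :
    ∫⁻ z, g (u + z) ∂(gaussianReal 0 1) = ∫⁻ z, gaussianTilt u z * g z ∂(gaussianReal 0 1) := by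
  have ht : Measurable (gaussianTilt u) := by unfold gaussianTilt; fun_prop
  rw [← lintegral_map hg (measurable_const_add u), gaussianReal_map_const_add, zero_add,
    gaussianReal_of_var_ne_zero _ one_ne_zero, gaussianReal_of_var_ne_zero _ one_ne_zero,
    lintegral_withDensity_eq_lintegral_mul _ (measurable_gaussianPDF _ _) hg,
    ← Pi.mul_def, lintegral_withDensity_eq_lintegral_mul _ (measurable_gaussianPDF _ _) (ht.mul hg)]
  refine lintegral_congr fun z => ?_
  simp only [Pi.mul_apply, ← mul_assoc]
  congr 1
  rw [gaussianPDF, gaussianPDF, gaussianTilt, ← ENNReal.ofReal_mul (gaussianPDFReal_nonneg _ _ _),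
    gaussianPDFReal, gaussianPDFReal, mul_assoc _ (Real.exp _), ← Real.exp_add]
  congr 3
  simp
  ring

lemma lintegral_gaussianTilt_sq (u : ℝ) :
    ∫⁻ z, gaussianTilt u z ^ 2 ∂(gaussianReal 0 1) = ENNReal.ofReal (Real.exp (u ^ 2)) := by
  have e : ∀ z, gaussianTilt u z ^ 2
      = ENNReal.ofReal (Real.exp (-u ^ 2)) * ENNReal.ofReal (Real.exp (2 * u * z)) := fun z => by
    rw [gaussianTilt, ← ENNReal.ofReal_pow (Real.exp_nonneg _), ← Real.exp_nat_mul,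
      ← ENNReal.ofReal_mul (Real.exp_nonneg _), ← Real.exp_add]
    congr 2
    push_cast
    ring
  have hm := congrFun (mgf_id_gaussianReal (μ := 0) (v := 1)) (2 * u)
  simp only [mgf, id] at hm
  simp_rw [e]
  rw [lintegral_const_mul _ (by fun_prop), ← ofReal_integral_eq_lintegral_ofReal
    (integrable_exp_mul_gaussianReal (2 * u)) (.of_forall fun _ => Real.exp_nonneg _), hm,
    ← ENNReal.ofReal_mul (Real.exp_nonneg _), ← Real.exp_add]
  congr 2
  simp
  ring

/-- For `v > 0` the integral is exactly `(1 - 2v)^(-1/2)`. It serves as the second moment of the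
likelihood ratio once the label noise is integrated out. -/
lemma lintegral_exp_sq_gaussianReal_le {v : NNReal} (hv : (v : ℝ) ≤ 1 / 4) :
    ∫⁻ u, ENNReal.ofReal (Real.exp (u ^ 2)) ∂(gaussianReal 0 v) ≤ ENNReal.ofReal (1 + 2 * v) := by
  by_cases h0 : v = 0
  · subst h0
    simp
  have hv0 : (0 : ℝ) < v := by positivity
  -- Chosen so that `exp (u ^ 2)` times the density is a multiple of `exp (-b * u ^ 2)`.
  set b : ℝ := 1 / (2 * v) - 1 with hb
  have hb0 : 0 < b := by
    rw [hb, sub_pos, lt_div_iff₀ (by positivity)]; linarith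
  rw [gaussianReal_of_var_ne_zero _ h0,
    lintegral_withDensity_eq_lintegral_mul _ (measurable_gaussianPDF _ _) (by fun_prop)]
  have e : ∀ u : ℝ, (gaussianPDF 0 v * fun u => ENNReal.ofReal (Real.exp (u ^ 2))) u
      = ENNReal.ofReal ((√(2 * Real.pi * v))⁻¹ * Real.exp (-b * u ^ 2)) := fun u => by
    rw [Pi.mul_apply, gaussianPDF, ← ENNReal.ofReal_mul (gaussianPDFReal_nonneg _ _ _),
      gaussianPDFReal, mul_assoc, ← Real.exp_add]
    congr 3
    rw [hb]
    field_simp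
    ring
  simp_rw [e]
  rw [← ofReal_integral_eq_lintegral_ofReal ((integrable_exp_neg_mul_sq hb0).const_mul _)
    (.of_forall fun _ => by positivity), integral_const_mul, integral_gaussian]
  apply ENNReal.ofReal_le_ofReal
  have hpi := Real.pi_pos
  rw [inv_mul_le_iff₀ (by positivity)]
  apply Real.sqrt_le_iff.2 ⟨by positivity, ?_⟩
  rw [mul_pow, Real.sq_sqrt (by positivity), div_le_iff₀ hb0, hb]
  have : 2 * Real.pi * v * (1 + 2 * (v : ℝ)) ^ 2 * (1 / (2 * v) - 1)
      = Real.pi * ((1 + 2 * v) ^ 2 * (1 - 2 * v)) := by field_simp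
  rw [this]
  have : (1 : ℝ) ≤ (1 + 2 * v) ^ 2 * (1 - 2 * v) := by nlinarith [mul_pos hv0 hv0]
  nlinarith

end Gaussian

/-! ### The isotropic regression instances -/

section Regression

variable {d : ℕ}

lemma posSemidef_smul_one {L : ℝ} (hL : 0 ≤ L) :
    (L • (1 : Matrix (Fin d) (Fin d) ℝ)).PosSemidef := Matrix.PosSemidef.one.smul hL

lemma predictionError_smul_one {L : ℝ} (hL : 0 ≤ L) (θ θ' : EuclideanSpace ℝ (Fin d)) :
    predictionError (L • (1 : Matrix (Fin d) (Fin d) ℝ)) θ θ' = √L * dist θ' θ := by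
  have h : CFC.sqrt (L • (1 : Matrix (Fin d) (Fin d) ℝ)) = √L • 1 := by
    refine CFC.sqrt_unique ?_ (posSemidef_smul_one (Real.sqrt_nonneg L)).nonneg
    rw [smul_mul_smul_comm, Real.mul_self_sqrt hL, one_mul]
  rw [predictionError, h, map_smul, map_one, smul_apply, norm_smul,
    Real.norm_of_nonneg (Real.sqrt_nonneg L), dist_comm, dist_eq_norm]
  rfl

lemma map_inner_multivariateGaussian_smul_one {L : ℝ} (hL : 0 ≤ L)
    (θ : EuclideanSpace ℝ (Fin d)) :
    (multivariateGaussian 0 (L • (1 : Matrix (Fin d) (Fin d) ℝ))).map (fun x => inner ℝ θ x)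
      = gaussianReal 0 (L * ‖θ‖ ^ 2).toNNReal := by
  have h1 : (fun x => inner ℝ θ x) = ⇑(innerSL ℝ θ) := rfl
  set μ := multivariateGaussian 0 (L • (1 : Matrix (Fin d) (Fin d) ℝ)) with hμ
  have hvar : Var[⇑(innerSL ℝ θ); μ] = L * ‖θ‖ ^ 2 := by
    rw [← h1, ← covariance_self (by fun_prop), ← covarianceBilin_apply_eq_cov
      IsGaussian.memLp_two_id, covarianceBilin_multivariateGaussian (posSemidef_smul_one hL)]
    rw [EuclideanSpace.real_norm_sq_eq, Finset.mul_sum]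
    simp only [Matrix.smul_mulVec, Matrix.one_mulVec, dotProduct, Pi.smul_apply, smul_eq_mul]
    exact Finset.sum_congr rfl fun i _ => by ring
  rw [h1, IsGaussian.map_eq_gaussianReal, hvar,
    ContinuousLinearMap.integral_comp_id_comm IsGaussian.integrable_id, hμ, integral_id_multivariateGaussian, map_zero]

instance isProbabilityMeasure_regressionLaw (S : Matrix (Fin d) (Fin d) ℝ)
    (θ : EuclideanSpace ℝ (Fin d)) : IsProbabilityMeasure (regressionLaw S θ) := by
  unfold regressionLaw
  exact Measure.isProbabilityMeasure_map (by fun_prop)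

lemma regressionLaw_zero (S : Matrix (Fin d) (Fin d) ℝ) :
    regressionLaw S 0 = (multivariateGaussian 0 S).prod (gaussianReal 0 1) := by
  simp [regressionLaw]

/-- The likelihood ratio of the regression instance with parameter `θ` against parameter `0`. -/
noncomputable def likelihoodRatio (θ : EuclideanSpace ℝ (Fin d))
    (p : EuclideanSpace ℝ (Fin d) × ℝ) : ℝ≥0∞ := gaussianTilt (inner ℝ θ p.1) p.2

lemma measurable_likelihoodRatio (θ : EuclideanSpace ℝ (Fin d)) :
    Measurable (likelihoodRatio θ) := by
  unfold likelihoodRatio gaussianTilt; fun_prop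

lemma regressionLaw_eq_withDensity (S : Matrix (Fin d) (Fin d) ℝ)
    (θ : EuclideanSpace ℝ (Fin d)) :
    regressionLaw S θ = (regressionLaw S 0).withDensity (likelihoodRatio θ) := by
  refine Measure.ext_of_lintegral _ fun f hf => ?_
  have hl := measurable_likelihoodRatio θ
  rw [lintegral_withDensity_eq_lintegral_mul _ hl hf, regressionLaw_zero, regressionLaw,
    lintegral_map hf (by fun_prop), lintegral_prod _ (by fun_prop),
    lintegral_prod _ (hl.mul hf).aemeasurable]
  refine lintegral_congr fun x => ?_
  exact lintegral_gaussianReal_add (inner ℝ θ x) (g := fun y => f (x, y)) (by fun_prop)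

lemma lintegral_likelihoodRatio (S : Matrix (Fin d) (Fin d) ℝ) (θ : EuclideanSpace ℝ (Fin d)) :
    ∫⁻ p, likelihoodRatio θ p ∂(regressionLaw S 0) = 1 := by
  have h : regressionLaw S θ Set.univ = 1 := measure_univ
  rwa [regressionLaw_eq_withDensity, withDensity_apply _ .univ, setLIntegral_univ] at h

lemma lintegral_likelihoodRatio_sq_le {L : ℝ} (hL : 0 ≤ L) (θ : EuclideanSpace ℝ (Fin d))
    (h : L * ‖θ‖ ^ 2 ≤ 1 / 4) :
    ∫⁻ p, likelihoodRatio θ p ^ 2 ∂(regressionLaw (L • 1) 0)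
      ≤ ENNReal.ofReal (1 + 2 * (L * ‖θ‖ ^ 2)) := by
  have h0 : 0 ≤ L * ‖θ‖ ^ 2 := by positivity
  rw [regressionLaw_zero,
    lintegral_prod _ ((measurable_likelihoodRatio θ).pow_const 2).aemeasurable]
  simp only [likelihoodRatio, lintegral_gaussianTilt_sq]
  rw [← lintegral_map (f := fun u : ℝ => ENNReal.ofReal (Real.exp (u ^ 2)))
    (g := fun x => inner ℝ θ x) (by fun_prop) (by fun_prop),
    map_inner_multivariateGaussian_smul_one hL]
  have := lintegral_exp_sq_gaussianReal_le (v := (L * ‖θ‖ ^ 2).toNNReal)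
    (by rwa [Real.coe_toNNReal _ h0])
  rwa [Real.coe_toNNReal _ h0] at this

end Regression

/-! ### Volume averaging in place of an explicit packing -/

section Packing

/-- A probability measure on `ℝ^d` gives mass at most `(a / r) ^ d` to some ball of radius `a`
centred within distance `r` of the origin. -/
lemma exists_measure_closedBall_le {d : ℕ} (ν : Measure (EuclideanSpace ℝ (Fin d)))
    [IsProbabilityMeasure ν] {a r : ℝ} (ha : 0 < a) (hr : 0 < r) :
    ∃ θ : EuclideanSpace ℝ (Fin d), ‖θ‖ ≤ r ∧
      ν (Metric.closedBall θ a) ≤ ENNReal.ofReal ((a / r) ^ d) := by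
  set B := Metric.closedBall (0 : EuclideanSpace ℝ (Fin d)) r
  have hB0 : volume B ≠ 0 := (Metric.measure_closedBall_pos volume _ hr).ne'
  have hBt : volume B ≠ ∞ := (isCompact_closedBall _ _).measure_lt_top.ne
  have hset : MeasurableSet {q : EuclideanSpace ℝ (Fin d) × EuclideanSpace ℝ (Fin d) |
      dist q.2 q.1 ≤ a} := measurableSet_le (by fun_prop) (by fun_prop)
  have hmeas : Measurable fun θ => ν (Metric.closedBall θ a) := measurable_measure_prodMk_left hset
  -- By Fubini and translation invariance, each output point lies in the balls of a set of centres
  -- of fixed volume.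
  have hint : ∫⁻ θ, ν (Metric.closedBall θ a)
      = volume (Metric.closedBall (0 : EuclideanSpace ℝ (Fin d)) a) := by
    have h1 := Measure.prod_apply (μ := (volume : Measure (EuclideanSpace ℝ (Fin d)))) (ν := ν) hset
    rw [Measure.prod_apply_symm hset] at h1
    calc ∫⁻ θ, ν (Metric.closedBall θ a) = ∫⁻ y, volume (Metric.closedBall y a) ∂ν := by
          refine h1.symm.trans (lintegral_congr fun y => ?_)
          congr 1
          ext θ
          simp [dist_comm]
      _ = ∫⁻ _, volume (Metric.closedBall (0 : EuclideanSpace ℝ (Fin d)) a) ∂ν :=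
          lintegral_congr fun y => Measure.addHaar_closedBall_center _ _ _
      _ = _ := by simp
  obtain ⟨θ, hθ, h⟩ := exists_le_setLAverage hB0 hBt hmeas.aemeasurable.restrict
  refine ⟨θ, by simpa [B] using hθ, h.trans ?_⟩
  rw [setLAverage_eq]
  refine ENNReal.div_le_of_le_mul ?_
  calc ∫⁻ θ in B, ν (Metric.closedBall θ a) ≤ ∫⁻ θ, ν (Metric.closedBall θ a) :=
        setLIntegral_le_lintegral _ _
    _ = volume (Metric.closedBall (0 : EuclideanSpace ℝ (Fin d)) (a / r * r)) := by
        rw [hint, div_mul_cancel₀ _ hr.ne']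
    _ = _ := by
        rw [Measure.addHaar_closedBall_mul _ _ (by positivity) hr.le, finrank_euclideanSpace_fin]

end Packing

/-! ### Sample-size bounds -/

section LowerBounds

variable {d n : ℕ} {L R α ε β : ℝ}
  {M : Kernel (Fin n → EuclideanSpace ℝ (Fin d) × ℝ) (EuclideanSpace ℝ (Fin d))}

/-- Privacy is assumed at distance exactly one; an update that changes nothing is covered by `1 ≤
exp ε`. -/
lemma IsPureDP.le_update {X O : Type*} [MeasurableSpace X] [MeasurableSpace O]
    {M : Kernel (Fin n → X) O} (hM : IsPureDP ε M) (hε : 0 ≤ ε) {A : Set O}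
    (hA : MeasurableSet A) (D : Fin n → X) (i : Fin n) (v : X) :
    M D A ≤ ENNReal.ofReal (Real.exp ε) * M (Function.update D i v) A := by
  classical
  by_cases h : D i = v
  · rw [← h, Function.update_eq_self]
    exact le_mul_of_one_le_left zero_le (ENNReal.one_le_ofReal.2 (Real.one_le_exp hε))
  · refine hM D _ ?_ A hA
    rw [hammingDist, Finset.card_eq_one]
    refine ⟨i, Finset.ext fun j => ?_⟩
    by_cases hj : j = i
    · subst hj; simpa using h
    · simp [hj]

lemma neg_log_le_of_le_pow_mul {T q : ℝ} (hT : 0 < T) (hq : 0 < q) {c : ℝ} (hc : 0 < c)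
    (h : ENNReal.ofReal c ≤ ENNReal.ofReal T ^ n * ENNReal.ofReal q) :
    -Real.log q ≤ n * Real.log T - Real.log c := by
  rw [← ENNReal.ofReal_pow hT.le, ← ENNReal.ofReal_mul (by positivity),
    ENNReal.ofReal_le_ofReal_iff (by positivity)] at h
  have := Real.log_le_log hc h
  rw [Real.log_mul (by positivity) hq.ne', Real.log_pow] at this
  linarith

/-- If the expected value of `F` is at least one half under the instance `θ` and at most `q` under
the instance `0`, then privacy forces `n ε ≳ log (1 / q)`. -/
lemma neg_log_le_of_private (S : Matrix (Fin d) (Fin d) ℝ) (θ : EuclideanSpace ℝ (Fin d))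
    {F : (Fin n → EuclideanSpace ℝ (Fin d) × ℝ) → ℝ≥0∞} (hF : Measurable F)
    (hr : ∀ D i v, F D ≤ ENNReal.ofReal (Real.exp ε) * F (Function.update D i v))
    {q : ℝ} (hq : 0 < q)
    (hP : ENNReal.ofReal (1 / 2) ≤ ∫⁻ D, F D ∂(Measure.pi fun _ => regressionLaw S θ))
    (hQ : ∫⁻ D, F D ∂(Measure.pi fun _ => regressionLaw S 0) ≤ ENNReal.ofReal q) :
    -Real.log q ≤ n * ε + Real.log 2 := by
  have h := lintegral_pi_le_of_bounded_ratio (P := regressionLaw S θ) (Q := regressionLaw S 0)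
    (fun f hf h => lintegral_le_of_bounded_ratio _ _ hf h) n F hF hr
  have := neg_log_le_of_le_pow_mul (Real.exp_pos ε) hq one_half_pos
    (hP.trans (h.trans (by gcongr)))
  rw [Real.log_exp, one_div, Real.log_inv] at this
  linarith

/-- Here `s` bounds the one-record total variation through the second moment, and `exp ε - 1 ≤ 2 *
ε` turns the gain per record into `2 * ε * s`. -/
lemma neg_log_le_of_private_of_close (hL : 0 ≤ L) (hε : 0 ≤ ε) (hε1 : ε ≤ 1)
    {θ : EuclideanSpace ℝ (Fin d)} {s : ℝ} (hs : 0 ≤ s)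
    (hθ : L * ‖θ‖ ^ 2 ≤ 1 / 4) (hθs : 2 * (L * ‖θ‖ ^ 2) ≤ s ^ 2)
    {F : (Fin n → EuclideanSpace ℝ (Fin d) × ℝ) → ℝ≥0∞} (hF : Measurable F)
    (hr : ∀ D i v, F D ≤ ENNReal.ofReal (Real.exp ε) * F (Function.update D i v))
    {q : ℝ} (hq : 0 < q)
    (hP : ENNReal.ofReal (1 / 2) ≤ ∫⁻ D, F D ∂(Measure.pi fun _ => regressionLaw (L • 1) θ))
    (hQ : ∫⁻ D, F D ∂(Measure.pi fun _ => regressionLaw (L • 1) 0) ≤ ENNReal.ofReal q) :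
    -Real.log q ≤ n * (2 * ε * s) + Real.log 2 := by
  have hb : 0 ≤ Real.exp ε - 1 := by linarith [Real.add_one_le_exp ε]
  have hb2 : Real.exp ε - 1 ≤ 2 * ε := by
    have h := Real.abs_exp_sub_one_le (x := ε) (by rwa [abs_of_nonneg hε])
    rwa [abs_of_nonneg hε, abs_of_nonneg hb] at h
  have hexp : ENNReal.ofReal (Real.exp ε) = 1 + ENNReal.ofReal (Real.exp ε - 1) := by
    rw [← ENNReal.ofReal_one, ← ENNReal.ofReal_add zero_le_one hb, add_sub_cancel]
  have hT : 1 + ENNReal.ofReal (Real.exp ε - 1) * ENNReal.ofReal s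
      = ENNReal.ofReal (1 + (Real.exp ε - 1) * s) := by
    rw [← ENNReal.ofReal_mul hb, ← ENNReal.ofReal_one,
      ← ENNReal.ofReal_add zero_le_one (by positivity)]
  have hδ : ∫⁻ p, (likelihoodRatio θ p - 1) ∂(regressionLaw (L • 1) 0) ≤ ENNReal.ofReal s := by
    refine lintegral_sub_one_le _ (measurable_likelihoodRatio θ) (lintegral_likelihoodRatio _ θ)
      ((lintegral_likelihoodRatio_sq_le hL θ hθ).trans ?_)
    rw [← ENNReal.ofReal_pow hs, ← ENNReal.ofReal_one,
      ← ENNReal.ofReal_add zero_le_one (by positivity)]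
    exact ENNReal.ofReal_le_ofReal (by linarith)
  have h := lintegral_pi_le_of_bounded_ratio (P := regressionLaw (L • 1) θ)
    (Q := regressionLaw (L • 1) 0) (a := ENNReal.ofReal (Real.exp ε))
    (T := ENNReal.ofReal (1 + (Real.exp ε - 1) * s)) (fun f hf h => by
      rw [regressionLaw_eq_withDensity _ θ, ← hT]
      exact lintegral_withDensity_le_of_bounded_ratio _ (measurable_likelihoodRatio θ)
        (lintegral_likelihoodRatio _ θ) ENNReal.ofReal_ne_top hδ hf (by rwa [← hexp])) n F hF hr
  have hlower := neg_log_le_of_le_pow_mul (T := 1 + (Real.exp ε - 1) * s) (by positivity) hq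
    one_half_pos (hP.trans (h.trans (by gcongr)))
  have hlog : Real.log (1 + (Real.exp ε - 1) * s) ≤ 2 * ε * s := by
    have h1 := Real.log_le_sub_one_of_pos (x := 1 + (Real.exp ε - 1) * s) (by positivity)
    have h2 : (Real.exp ε - 1) * s ≤ 2 * ε * s := by gcongr
    linarith
  have hnlog := mul_le_mul_of_nonneg_left hlog (Nat.cast_nonneg (α := ℝ) n)
  rw [one_div, Real.log_inv] at hlower
  linarith

/-- The privacy-free transfer: `F ^ 2 ≤ F` lets the second moment under the null instance be bounded
by `q`. -/
lemma neg_log_le_of_close (hL : 0 ≤ L) {θ : EuclideanSpace ℝ (Fin d)}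
    (hθ : L * ‖θ‖ ^ 2 ≤ 1 / 4)
    {F : (Fin n → EuclideanSpace ℝ (Fin d) × ℝ) → ℝ≥0∞} (hF : Measurable F)
    (hF1 : ∀ D, F D ≤ 1) {q : ℝ} (hq : 0 < q)
    (hP : ENNReal.ofReal (1 / 2) ≤ ∫⁻ D, F D ∂(Measure.pi fun _ => regressionLaw (L • 1) θ))
    (hQ : ∫⁻ D, F D ∂(Measure.pi fun _ => regressionLaw (L • 1) 0) ≤ ENNReal.ofReal q) :
    -Real.log q ≤ n * (2 * (L * ‖θ‖ ^ 2)) + 2 * Real.log 2 := by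
  have h0 : 0 ≤ L * ‖θ‖ ^ 2 := by positivity
  have h := sq_lintegral_pi_le (P := regressionLaw (L • 1) θ)
    (Q := regressionLaw (L • 1) 0) (K := ENNReal.ofReal (1 + 2 * (L * ‖θ‖ ^ 2)))
    (fun f hf => by
      rw [regressionLaw_eq_withDensity _ θ]
      exact sq_lintegral_withDensity_le _ (measurable_likelihoodRatio θ)
        (lintegral_likelihoodRatio_sq_le hL θ hθ) hf) n F hF
  have hFQ : ∫⁻ D, F D ^ 2 ∂(Measure.pi fun _ => regressionLaw (L • 1) 0) ≤ ENNReal.ofReal q :=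
    (lintegral_mono fun D => pow_le_of_le_one zero_le (hF1 D) two_ne_zero).trans hQ
  have hP2 : ENNReal.ofReal ((1 / 2) ^ 2)
      ≤ (∫⁻ D, F D ∂(Measure.pi fun _ => regressionLaw (L • 1) θ)) ^ 2 := by
    rw [ENNReal.ofReal_pow (by norm_num)]
    gcongr
  have hlower := neg_log_le_of_le_pow_mul (T := 1 + 2 * (L * ‖θ‖ ^ 2)) (by positivity) hq
    (by positivity) (hP2.trans (h.trans (by gcongr)))
  have hlog := Real.log_le_sub_one_of_pos (x := 1 + 2 * (L * ‖θ‖ ^ 2)) (by positivity)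
  rw [add_sub_cancel_left] at hlog
  have hnlog := mul_le_mul_of_nonneg_left hlog (Nat.cast_nonneg (α := ℝ) n)
  rw [Real.log_pow, one_div, Real.log_inv] at hlower
  push_cast at hlower
  linarith

/-- Every accurate algorithm is likely to output a point near the true parameter. -/
lemma IsAccurate.le_closedBall (hM : IsAccurate L R α β M) (hL : 0 < L)
    {θ : EuclideanSpace ℝ (Fin d)} (hθ : ‖θ‖ ≤ R) :
    ENNReal.ofReal (1 - β) ≤ (Measure.pi fun _ : Fin n => regressionLaw (L • 1) θ).bind M
      (Metric.closedBall θ (α / √L)) := by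
  have h := hM (L • 1) θ (posSemidef_smul_one hL.le) (by simpa using Matrix.PosSemidef.zero) hθ
  convert h using 2
  ext θ'
  rw [Metric.mem_closedBall, Set.mem_ofPred_eq, predictionError_smul_one hL.le,
    le_div_iff₀ (Real.sqrt_pos.2 hL), mul_comm]

/-- The sample-size bounds forced by an instance `θ` whose success event has probability at most
`q` under the instance `0`. -/
lemma neg_log_le_of_isAccurate (hL : 0 < L) (hα : 0 < α) (hε : 0 < ε) (hε1 : ε < 1)
    (hβ : β ≤ 1 / 2) [IsMarkovKernel M] (hdp : IsPureDP ε M)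
    (hacc : IsAccurate L R α β M)
    {θ : EuclideanSpace ℝ (Fin d)} (hθ : ‖θ‖ ≤ R) {q : ℝ} (hq : 0 < q)
    (hQ : (Measure.pi fun _ : Fin n => regressionLaw (L • 1) 0).bind M
      (Metric.closedBall θ (α / √L)) ≤ ENNReal.ofReal q) :
    -Real.log q ≤ n * ε + Real.log 2 ∧
    (α ≤ 1 / 16 → ‖θ‖ ≤ 8 * (α / √L) → -Real.log q ≤ 24 * (n * α * ε) + Real.log 2 ∧
      -Real.log q ≤ 128 * (n * α ^ 2) + 2 * Real.log 2) := by
  have hA : MeasurableSet (Metric.closedBall θ (α / √L)) := measurableSet_closedBall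
  have hP := (ENNReal.ofReal_le_ofReal (by linarith : 1 / 2 ≤ 1 - β)).trans
    (hacc.le_closedBall hL hθ)
  rw [Measure.bind_apply hA M.measurable.aemeasurable] at hP hQ
  have hF := M.measurable_coe hA
  have hr := hdp.le_update hε.le hA
  refine ⟨neg_log_le_of_private _ θ hF hr hq hP hQ, fun hα1 hθ8 => ?_⟩
  have hv : L * ‖θ‖ ^ 2 ≤ 64 * α ^ 2 := by
    calc L * ‖θ‖ ^ 2 ≤ L * (8 * (α / √L)) ^ 2 := by gcongr
      _ = 64 * α ^ 2 := by
        rw [mul_pow, div_pow, Real.sq_sqrt hL.le]; field_simp; norm_num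
  have hv4 : L * ‖θ‖ ^ 2 ≤ 1 / 4 := hv.trans (by nlinarith)
  constructor
  -- `s ^ 2 = 144 * α ^ 2` dominates `2 * 64 * α ^ 2`.
  · have := neg_log_le_of_private_of_close (s := 12 * α) hL.le hε.le hε1.le (by positivity) hv4
      (by nlinarith) hF hr hq hP hQ
    linarith
  · have := neg_log_le_of_close hL.le hv4 hF (fun D => prob_le_one) hq hP hQ
    have h2 := mul_le_mul_of_nonneg_left hv (Nat.cast_nonneg (α := ℝ) n)
    linarith

lemma sample_size_lower_bound (hd : 1 ≤ d) (hL : 0 < L) (hα : 0 < α) (hR : 8 * α / √L < R)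
    (hε : 0 < ε) (hε1 : ε < 1) (hβ0 : 0 < β) (hβ : β ≤ 1 / 2) [IsMarkovKernel M]
    (hdp : IsPureDP ε M) (hacc : IsAccurate L R α β M) :
    d * Real.log (R * √L / α) + Real.log (1 / β) ≤ 3 * (n * ε) ∧
    d + Real.log (1 / β) ≤ 800 * (n * α * ε) ∧
    d + Real.log (1 / β) ≤ 800 * (n * α ^ 2) := by
  have hsL : 0 < √L := Real.sqrt_pos.2 hL
  set a := α / √L with ha
  have ha0 : 0 < a := by positivity
  have hR8 : 8 * a < R := by rwa [ha, ← mul_div_assoc]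
  have hR0 : 0 < R := by linarith
  have hn : (0 : ℝ) ≤ n := n.cast_nonneg
  have hd' : (1 : ℝ) ≤ d := by exact_mod_cast hd
  have hln := Real.log_two_gt_d9
  have hlog8 : Real.log 8 = 3 * Real.log 2 := by
    rw [show (8 : ℝ) = 2 ^ 3 by norm_num, Real.log_pow]; norm_num
  have hρ : 8 < R * √L / α := by
    rw [lt_div_iff₀ hα]; rw [ha] at hR8
    calc 8 * α = 8 * (α / √L) * √L := by field_simp
      _ < R * √L := by gcongr
  have hlogρ : 3 * Real.log 2 ≤ Real.log (R * √L / α) := by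
    rw [← hlog8]; exact Real.log_le_log (by norm_num) hρ.le
  have hℓ : Real.log 2 ≤ Real.log (1 / β) :=
    Real.log_le_log (by norm_num) (by rw [le_div_iff₀ hβ0]; linarith)
  have hlogβ : -Real.log β = Real.log (1 / β) := by rw [one_div, Real.log_inv]
  set ν := (Measure.pi fun _ : Fin n => regressionLaw (L • (1 : Matrix (Fin d) (Fin d) ℝ)) 0).bind M
    with hν
  have : IsProbabilityMeasure ν := by rw [hν]; infer_instance
  obtain ⟨θ₁, hθ₁, hQ₁⟩ := exists_measure_closedBall_le ν ha0 hR0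
  obtain ⟨θ₂, hθ₂, hQ₂⟩ := exists_measure_closedBall_le ν ha0 (r := 8 * a) (by positivity)
  have hθ₃ : ‖EuclideanSpace.single (⟨0, hd⟩ : Fin d) (8 * a)‖ = 8 * a := by
    simp [abs_of_pos ha0]
  set θ₃ : EuclideanSpace ℝ (Fin d) := EuclideanSpace.single (⟨0, hd⟩ : Fin d) (8 * a)
  have hQ₃ : ν (Metric.closedBall θ₃ a) ≤ ENNReal.ofReal β := by
    have hdisj : Metric.closedBall θ₃ a ⊆ (Metric.closedBall 0 a)ᶜ :=
      (Metric.closedBall_disjoint_closedBall (by rw [dist_zero_right, hθ₃]; linarith)).subset_compl_right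
    have h0 := hacc.le_closedBall hL (θ := 0) (by simpa using hR0.le)
    calc ν (Metric.closedBall θ₃ a) ≤ ν (Metric.closedBall 0 a)ᶜ := measure_mono hdisj
      _ = 1 - ν (Metric.closedBall 0 a) := prob_compl_eq_one_sub measurableSet_closedBall
      _ ≤ 1 - ENNReal.ofReal (1 - β) := tsub_le_tsub_left h0 _
      _ = ENNReal.ofReal β := by
        rw [← ENNReal.ofReal_one, ← ENNReal.ofReal_sub _ (by linarith), sub_sub_cancel]
  obtain ⟨h1, -⟩ := neg_log_le_of_isAccurate hL hα hε hε1 hβ hdp hacc hθ₁ (by positivity) hQ₁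
  obtain ⟨-, h2⟩ := neg_log_le_of_isAccurate hL hα hε hε1 hβ hdp hacc (hθ₂.trans hR8.le)
    (by positivity) hQ₂
  obtain ⟨h3, h4⟩ := neg_log_le_of_isAccurate hL hα hε hε1 hβ hdp hacc (hθ₃.le.trans hR8.le)
    hβ0 hQ₃
  have e1 : -Real.log ((a / R) ^ d) = d * Real.log (R * √L / α) := by
    rw [Real.log_pow, ← mul_neg, ← Real.log_inv, inv_div, ha, div_div_eq_mul_div]
  have e2 : -Real.log ((a / (8 * a)) ^ d) = d * (3 * Real.log 2) := by
    rw [Real.log_pow, ← mul_neg, ← Real.log_inv, inv_div, mul_div_cancel_right₀ _ ha0.ne', hlog8]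
  rw [e1] at h1
  rw [e2] at h2
  rw [hlogβ] at h3 h4
  have hD : d * (3 * Real.log 2) ≤ d * Real.log (R * √L / α) := by gcongr
  have hdl : Real.log 2 ≤ d * Real.log 2 := le_mul_of_one_le_left (by linarith) hd'
  have hdd : (d : ℝ) ≤ 2 * (d * Real.log 2) := by nlinarith
  -- Adding `h1` and `h3` leaves `2 * Real.log 2`, absorbed by a third `n * ε`: `h1` and `hlogρ`
  -- force `n * ε ≥ 2 * Real.log 2`.
  have hI : d * Real.log (R * √L / α) + Real.log (1 / β) ≤ 3 * (n * ε) := by linarith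
  refine ⟨hI, ?_⟩
  rcases le_or_gt α (1 / 16) with hα1 | hα1
  · obtain ⟨h2a, h2b⟩ := h2 hα1 hθ₂
    obtain ⟨h4a, h4b⟩ := h4 hα1 hθ₃.le
    constructor <;> linarith
  -- For `α > 1 / 16` closeness is not needed: `1 < 16 * α` turns `hI` into both bounds, the last
  -- one also using `ε < 1`.
  · have hnε : 0 ≤ n * ε := by positivity
    have hII : d + Real.log (1 / β) ≤ 48 * (n * α * ε) := by nlinarith
    have hnα : 0 ≤ n * α := by positivity
    exact ⟨by nlinarith, by nlinarith⟩

end LowerBounds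

end PrivateRegression

theorem mainTheorem9 :
    ∃ c : ℝ, 0 < c ∧
      ∀ (d n : ℕ) (L R α ε β : ℝ),
        1 ≤ d → 1 < L → 0 < α → 8 * α / Real.sqrt L < R →
        0 < ε → ε < 1 → 0 < β → β ≤ 1 / 2 →
        ∀ M : Kernel (Fin n → EuclideanSpace ℝ (Fin d) × ℝ) (EuclideanSpace ℝ (Fin d)),
          IsMarkovKernel M →
          PrivateRegression.IsPureDP ε M →
          PrivateRegression.IsAccurate L R α β M →
          c * ((d + Real.log (1 / β)) / α ^ 2
              + (d + Real.log (1 / β)) / (α * ε)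
              + (d * Real.log (R * Real.sqrt L / α) + Real.log (1 / β)) / ε) ≤ (n : ℝ) := by
  -- The three terms are at most `800 * n`, `800 * n` and `3 * n`.
  refine ⟨1 / 2000, by norm_num, ?_⟩
  intro d n L R α ε β hd hL hα hR hε hε1 hβ0 hβ M hM hdp hacc
  obtain ⟨h1, h2, h3⟩ := PrivateRegression.sample_size_lower_bound hd (by linarith) hα hR hε hε1
    hβ0 hβ hdp hacc
  have h1' := (div_le_iff₀ hε).2 (h1.trans_eq (by ring : _ = 3 * (n : ℝ) * ε))
  have h2' := (div_le_iff₀ (mul_pos hα hε)).2 (h2.trans_eq (by ring : _ = 800 * (n : ℝ) * (α * ε)))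
  have h3' := (div_le_iff₀ (pow_pos hα 2)).2 (h3.trans_eq (by ring : _ = 800 * (n : ℝ) * α ^ 2))
  have hn : (0 : ℝ) ≤ n := n.cast_nonneg
  linarith
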